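/- Theorem 3.4. There is an absolute constant $c>0$ such that the following holds. Let $G=(V,E)$ be a finite, simple, undirected, connected graph with $n=|V|$ vertices and $m=|E|$ edges, and let $k$ be an integer with $1\le k\le c\, n\log n$ (natural logarithm). Let $X^{(1)},\dots,X^{(k)}$ be independent simple random walks on $G$ in discrete time (at each step a walk moves to a uniformly random neighbour of its current vertex), whose starting vertices are independent samples from the stationary distribution $\pi(v)=\deg(v)/(2m)$. Let $\tau_{\mathrm{cov}}^{(k)}=\inf\{t\ge 0:\ \bigcup_{s=0}^{t}\{X^{(1)}_s,\dots,X^{(k)}_s\}=V\}$ and $t_{\mathrm{cov}}^{(k)}(\pi)=\mathbb{E}_{\pi^k}\bigl[\tau_{\mathrm{cov}}^{(k)}\bigr]$. Then $$t_{\mathrm{cov}}^{(k)}(\pi)\ \ge\ c\cdot\frac{n}{k}\cdot\log n .$$ The same bound, with the same constant $c$, holds when the walks are instead lazy, i.e. when at each step each walk independently stays at its current vertex with probability $1/2$ and otherwise moves to a uniformly random neighbour. -/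

import Mathlib

open MeasureTheory ProbabilityTheory
open scoped ENNReal

namespace MultipleWalks

/-- One step of the (non-lazy) simple random walk on `G` from `u`: a uniformly random neighbour
of `u`. At an isolated vertex the walk stays put. -/
noncomputable def simpleStep {V : Type*} [Fintype V] (G : SimpleGraph V) [DecidableRel G.Adj]
    (u : V) : PMF V :=
  if h : (G.neighborFinset u).Nonempty then PMF.uniformOfFinset (G.neighborFinset u) h
  else PMF.pure u

/-- One step of the lazy random walk on `G` from `u`: a fair coin decides between staying at `u`
and making a step of the simple random walk. -/
noncomputable def lazyStep {V : Type*} [Fintype V] (G : SimpleGraph V) [DecidableRel G.Adj]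
    (u : V) : PMF V :=
  (PMF.uniformOfFintype Bool).bind fun b => if b then PMF.pure u else simpleStep G u

/-- The measure `π(v) = d(v) / (2 m)` on the vertices of `G`, where `m` is the number of edges. -/
noncomputable def stationary {V : Type*} [Fintype V] [MeasurableSpace V]
    (G : SimpleGraph V) [DecidableRel G.Adj] : Measure V :=
  ∑ v : V, ((G.degree v : ℝ≥0∞) / (2 * (G.edgeFinset.card : ℝ≥0∞))) • Measure.dirac v

section Chain

variable {V : Type*} [Countable V] [MeasurableSpace V] [DiscreteMeasurableSpace V]

/-- The transition probabilities `P` as a Markov kernel on `V`. -/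
noncomputable def stepKernel (P : V → PMF V) : Kernel V V :=
  Kernel.ofFunOfCountable fun u => (P u).toMeasure

instance (P : V → PMF V) : IsMarkovKernel (stepKernel P) :=
  ⟨fun u => inferInstanceAs (IsProbabilityMeasure (P u).toMeasure)⟩

/-- The conditional law of the position at time `n + 1` given the trajectory up to time `n`: a step
of `P` from the position at time `n`. -/
noncomputable def historyKernel (P : V → PMF V) (n : ℕ) :
    Kernel ((_ : Finset.Iic n) → V) V :=
  (stepKernel P).comap (fun p => p ⟨n, Finset.mem_Iic.2 le_rfl⟩) (measurable_pi_apply _)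

instance (P : V → PMF V) (n : ℕ) : IsMarkovKernel (historyKernel P n) :=
  inferInstanceAs (IsMarkovKernel ((stepKernel P).comap _ _))

/-- The law on trajectories `ℕ → V` of the Markov chain with transition probabilities `P` whose
position at time `0` has law `μ`. -/
noncomputable def chainLaw (P : V → PMF V) (μ : Measure V) : Measure (ℕ → V) :=
  Kernel.trajMeasure (X := fun _ => V) μ (historyKernel P)

/-- The law of `k` independent Markov chains, each with transition probabilities `P` and each with
initial law `μ`. -/
noncomputable def multiChainLaw (P : V → PMF V) (μ : Measure V) (k : ℕ) :
    Measure (Fin k → ℕ → V) :=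
  Measure.pi fun _ => chainLaw P μ

end Chain

/-- The first time `t` such that every vertex has been visited by one of the `k` trajectories at
one of the times `0, …, t`; it is `∞` if there is no such time. -/
noncomputable def coverTime {V : Type*} {k : ℕ} (X : Fin k → ℕ → V) : ℝ≥0∞ :=
  ⨅ (t : ℕ) (_ : ∀ v : V, ∃ i : Fin k, ∃ s ≤ t, X i s = v), (t : ℝ≥0∞)

/-- The expected cover time of `k` independent chains with transition probabilities `P`, each
started from an independent sample of `μ`. -/
noncomputable def expectedCoverTime {V : Type*} [Countable V] [MeasurableSpace V]
    [DiscreteMeasurableSpace V] (P : V → PMF V) (μ : Measure V) (k : ℕ) : ℝ≥0∞ :=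
  ∫⁻ X, coverTime X ∂(multiChainLaw P μ k)

end MultipleWalks

set_option linter.unusedSectionVars false

/-! The `k` walks are compared with a single walk that restarts from `π` at rate `l = 1 / (t + 1)`.
Restarting keeps `π` reversible and makes every transition probability positive, so periodicity
plays no role and hitting times obey a one-step minimum principle. Only reversibility and positivity
of `π` matter, hence simple and lazy walks are treated alike.

Lower bound (`cover_ge`): any positive reversible chain needs time of order `n log n` to cover from
`π`. At least half of the vertices have `π a ≤ 2 / n`, so commute times from them are at least `n /
2` (`commute_ge`). By `hit_symm` the two directions of a commute differ by the difference of the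
hitting times from `π`. If these all lie below `n log n`, pigeonhole gives about `√n` light vertices
with nearly equal values, hence pairwise hitting times at least `n / 8`; `matthews_lower_bound` then
yields the logarithm.

Upper bound (`meanCoverFrom_restart_le`): let `B R` be the mean time for the restarted chain to
cover `R` from `π`. One unrestarted walk of length `t` costs the restarted chain `O(t + 1)`, that
is, `B R ≤ 3 (t + 1) + E[B (R \ D)]` with `D` the range of the walk. Iterating over `k` independent
walks leaves `B` of the set missed by all of them. If `t + 1` is at least twice their expected cover
time, Markov's inequality bounds this remainder by `B V / 2`, so `B V ≤ 6 k (t + 1)`. Comparing the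
two bounds finishes the proof. -/

namespace MultipleWalks

/-! ### Mean cover times of positive chains and Matthews' bound. -/

section CoverFunction

variable {V : Type*} [Fintype V] [DecidableEq V]

/-- The expectation of `min τ T`, where `τ` is the time at which the chain with transition matrix
`P` started at `u` has visited all of `R`. -/
noncomputable def cappedCover (P : V → V → ℝ) : ℕ → V → Finset V → ℝ
  | 0, _, _ => 0
  | T + 1, u, R => if R.erase u = ∅ then 0 else 1 + ∑ w, P u w * cappedCover P T w (R.erase u)

/-- The expected time at which the chain with transition matrix `P` started at `u` has visited all
of `R`. -/
noncomputable def meanCover (P : V → V → ℝ) (u : V) (R : Finset V) : ℝ :=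
  ⨆ T, cappedCover P T u R

/-- The expected time to visit all of `R` when the initial vertex has law `π`. -/
noncomputable def meanCoverFrom (P : V → V → ℝ) (π : V → ℝ) (R : Finset V) : ℝ :=
  ∑ u, π u * meanCover P u R

variable {P : V → V → ℝ}

lemma cappedCover_nonneg (hP : ∀ u w, 0 ≤ P u w) (T : ℕ) (u : V) (R : Finset V) :
    0 ≤ cappedCover P T u R := by
  induction T generalizing u R with
  | zero => simp [cappedCover]
  | succ T ih =>
    rw [cappedCover]
    split_ifs
    · exact le_rfl
    · exact add_nonneg zero_le_one (Finset.sum_nonneg fun w _ => mul_nonneg (hP u w) (ih _ _))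

lemma cappedCover_monotone (hP : ∀ u w, 0 ≤ P u w) (u : V) (R : Finset V) :
    Monotone fun T => cappedCover P T u R := by
  refine monotone_nat_of_le_succ fun T => ?_
  induction T generalizing u R with
  | zero => exact cappedCover_nonneg hP 1 u R
  | succ T ih =>
    rw [cappedCover, cappedCover]
    split_ifs
    · exact le_rfl
    · gcongr with w
      · exact hP u w
      · exact ih _ _

lemma cappedCover_mono (hP : ∀ u w, 0 ≤ P u w) (T : ℕ) (u : V) {R S : Finset V} (h : R ⊆ S) :
    cappedCover P T u R ≤ cappedCover P T u S := by
  induction T generalizing u R S with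
  | zero => simp [cappedCover]
  | succ T ih =>
    have h' : R.erase u ⊆ S.erase u := Finset.erase_subset_erase u h
    by_cases hR : R.erase u = ∅
    · rw [cappedCover, if_pos hR]
      exact cappedCover_nonneg hP _ _ _
    · have hS : S.erase u ≠ ∅ := fun hS => hR (Finset.subset_empty.1 (hS ▸ h'))
      rw [cappedCover, cappedCover, if_neg hR, if_neg hS]
      gcongr with w
      · exact hP u w
      · exact ih _ h'

lemma cappedCover_erase (T : ℕ) (u : V) (R : Finset V) :
    cappedCover P T u (R.erase u) = cappedCover P T u R := by
  cases T with
  | zero => rfl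
  | succ T => rw [cappedCover, cappedCover, Finset.erase_idem]

/-- Each missing vertex is hit with probability at least `ε` per step, so it costs at most `1 / ε`.
The bound is uniform in `T`, which keeps the supremum in `meanCover` from being a junk value. -/
lemma cappedCover_le {ε : ℝ} (hε : 0 < ε) (hP : ∀ u w, ε ≤ P u w) (hsum : ∀ u, ∑ w, P u w = 1)
    (T : ℕ) (u : V) (R : Finset V) : cappedCover P T u R ≤ R.card / ε := by
  induction T generalizing u R with
  | zero => simp only [cappedCover]; positivity
  | succ T ih =>
    rw [cappedCover]
    split_ifs with hR
    · positivity
    · obtain ⟨s, hs⟩ := Finset.nonempty_iff_ne_empty.2 hR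
      set S := R.erase u
      have hSR : (S.card : ℝ) ≤ R.card := by exact_mod_cast Finset.card_le_card (R.erase_subset u)
      -- Landing on the chosen missing vertex `s` saves `1 / ε`; on average this pays for the unit
      -- step.
      have hw : ∀ w, cappedCover P T w S ≤ S.card / ε - if w = s then 1 / ε else 0 := by
        intro w
        split_ifs with hws
        · subst hws
          have h1 := ih w (S.erase w)
          rw [cappedCover_erase, Finset.card_erase_of_mem hs,
            Nat.cast_sub (Finset.card_pos.2 ⟨w, hs⟩)] at h1
          rw [← sub_div]
          simpa using h1
        · simpa using ih w S
      have h2 : ∑ w, P u w * cappedCover P T w S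
          ≤ ∑ w, P u w * (S.card / ε - if w = s then 1 / ε else 0) := by
        gcongr with w
        · exact hε.le.trans (hP u w)
        · exact hw w
      have h3 : ∑ w, P u w * (S.card / ε - if w = s then 1 / ε else 0)
          = S.card / ε - P u s / ε := by
        simp only [mul_sub, Finset.sum_sub_distrib, ← Finset.sum_mul, hsum, one_mul, mul_ite,
          mul_zero, Finset.sum_ite_eq', Finset.mem_univ, if_true, mul_one_div]
      have h4 : 1 ≤ P u s / ε := (one_le_div hε).2 (hP u s)
      have h5 : (S.card : ℝ) / ε ≤ R.card / ε := by gcongr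
      linarith

/-- A transition matrix with positive entries. -/
structure IsPositiveChain (P : V → V → ℝ) : Prop where
  pos : ∀ u w, 0 < P u w
  sum_eq_one : ∀ u, ∑ w, P u w = 1

namespace IsPositiveChain

lemma nonneg (h : IsPositiveChain P) (u w : V) : 0 ≤ P u w := (h.pos u w).le

lemma bddAbove (h : IsPositiveChain P) (u : V) (R : Finset V) :
    BddAbove (Set.range fun T => cappedCover P T u R) := by
  have : Nonempty V := ⟨u⟩
  obtain ⟨p, hp⟩ := Finite.exists_min fun q : V × V => P q.1 q.2
  refine ⟨R.card / P p.1 p.2, ?_⟩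
  rintro _ ⟨T, rfl⟩
  exact cappedCover_le (h.pos _ _) (fun u w => hp (u, w)) h.sum_eq_one T u R

lemma tendsto_cappedCover (h : IsPositiveChain P) (u : V) (R : Finset V) :
    Filter.Tendsto (fun T => cappedCover P T u R) Filter.atTop (nhds (meanCover P u R)) :=
  tendsto_atTop_ciSup (cappedCover_monotone h.nonneg u R) (h.bddAbove u R)

lemma meanCover_nonneg (h : IsPositiveChain P) (u : V) (R : Finset V) : 0 ≤ meanCover P u R :=
  le_ciSup_of_le (h.bddAbove u R) 0 (cappedCover_nonneg h.nonneg 0 u R)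

lemma meanCover_mono (h : IsPositiveChain P) (u : V) {R S : Finset V} (hRS : R ⊆ S) :
    meanCover P u R ≤ meanCover P u S :=
  ciSup_mono (h.bddAbove u S) fun T => cappedCover_mono h.nonneg T u hRS

lemma meanCover_erase (u : V) (R : Finset V) :
    meanCover P u (R.erase u) = meanCover P u R := by
  simp only [meanCover, cappedCover_erase]

lemma meanCover_of_erase_eq_empty (h : IsPositiveChain P) {u : V} {R : Finset V}
    (hR : R.erase u = ∅) : meanCover P u R = 0 := by
  refine tendsto_nhds_unique (h.tendsto_cappedCover u R) ?_
  refine tendsto_const_nhds.congr fun T => ?_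
  cases T with
  | zero => rfl
  | succ T => rw [cappedCover, if_pos hR]

lemma meanCover_eq (h : IsPositiveChain P) {u : V} {R : Finset V} (hR : R.erase u ≠ ∅) :
    meanCover P u R = 1 + ∑ w, P u w * meanCover P w (R.erase u) := by
  refine tendsto_nhds_unique
    ((h.tendsto_cappedCover u R).comp (Filter.tendsto_add_atTop_nat 1)) ?_
  have h1 : Filter.Tendsto
      (fun T => 1 + ∑ w, P u w * cappedCover P T w (R.erase u)) Filter.atTop
      (nhds (1 + ∑ w, P u w * meanCover P w (R.erase u))) :=
    tendsto_const_nhds.add (tendsto_finsetSum _ fun w _ =>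
      tendsto_const_nhds.mul (h.tendsto_cappedCover w _))
  refine h1.congr fun T => ?_
  simp only [Function.comp_apply]
  rw [cappedCover, if_neg hR]

lemma meanCover_le (h : IsPositiveChain P) (u : V) (R : Finset V) :
    meanCover P u R ≤ 1 + ∑ w, P u w * meanCover P w (R.erase u) := by
  by_cases hR : R.erase u = ∅
  · rw [h.meanCover_of_erase_eq_empty hR]
    exact add_nonneg zero_le_one
      (Finset.sum_nonneg fun w _ => mul_nonneg (h.nonneg u w) (h.meanCover_nonneg _ _))
  · exact (h.meanCover_eq hR).le

/-- The minimum principle for functions that are harmonic off a nonempty set. -/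
lemma le_of_harmonic_off (h : IsPositiveChain P) {f : V → ℝ} {R : Finset V} (hR : R.Nonempty)
    {b : ℝ} (hb : ∀ u ∈ R, b ≤ f u) (hf : ∀ u ∉ R, f u = ∑ w, P u w * f w) (u : V) : b ≤ f u := by
  have : Nonempty V := ⟨u⟩
  obtain ⟨m, hm⟩ := Finite.exists_min f
  refine le_trans ?_ (hm u)
  by_cases hmR : m ∈ R
  · exact hb m hmR
  · obtain ⟨s, hs⟩ := hR
    -- At a minimum off `R`, harmonicity and positive entries force equality everywhere, in
    -- particular at a point of `R`.
    have h0 : ∑ w, P m w * (f w - f m) = 0 := by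
      simp only [mul_sub, Finset.sum_sub_distrib, ← Finset.sum_mul, h.sum_eq_one, one_mul]
      rw [← hf m hmR, sub_self]
    have h1 := (Finset.sum_eq_zero_iff_of_nonneg fun w _ =>
      mul_nonneg (h.nonneg m w) (sub_nonneg.2 (hm w))).1 h0 s (Finset.mem_univ s)
    have h2 : f s - f m = 0 := (mul_eq_zero.1 h1).resolve_left (h.pos m s).ne'
    linarith [hb s hs]

lemma hit_self (h : IsPositiveChain P) (a : V) : meanCover P a {a} = 0 :=
  h.meanCover_of_erase_eq_empty (by simp)

lemma hit_eq (h : IsPositiveChain P) {a u : V} (hu : u ≠ a) :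
    meanCover P u {a} = 1 + ∑ w, P u w * meanCover P w {a} := by
  have he : ({a} : Finset V).erase u = {a} := Finset.erase_eq_of_notMem (by simpa using hu)
  rw [h.meanCover_eq (by rw [he]; simp), he]

/-- The difference of the two sides is harmonic off `{a, b}` and nonnegative on it. -/
lemma hit_triangle (h : IsPositiveChain P) (a b u : V) :
    meanCover P u {a} ≤ meanCover P u {b} + meanCover P b {a} := by
  have key := h.le_of_harmonic_off (R := {a, b}) (b := 0)
    (f := fun u => meanCover P u {b} + meanCover P b {a} - meanCover P u {a}) ⟨a, by simp⟩ ?_ ?_ u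
  · simpa using key
  · intro v hv
    rcases Finset.mem_insert.1 hv with rfl | hv
    · rw [h.hit_self]
      linarith [h.meanCover_nonneg v {b}, h.meanCover_nonneg b {v}]
    · rw [Finset.mem_singleton.1 hv, h.hit_self]
      linarith
  · intro v hv
    rw [Finset.mem_insert, Finset.mem_singleton, not_or] at hv
    rw [h.hit_eq hv.1, h.hit_eq hv.2]
    simp only [mul_sub, mul_add, Finset.sum_sub_distrib, Finset.sum_add_distrib, ← Finset.sum_mul,
      h.sum_eq_one]
    ring

/-- Deleting `v` shortens the cover time only when `v` is the last vertex of `R` to be reached, so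
the sum is the mean time between the last two first visits. That is a hitting time between two
points of `A`. This replaces the random ordering in Matthews' argument. -/
lemma meanCover_sum_sub_ge (h : IsPositiveChain P) {A : Finset V} {b : ℝ}
    (hA : ∀ u ∈ A, ∀ v ∈ A, u ≠ v → b ≤ meanCover P u {v}) :
    ∀ R ⊆ A, 2 ≤ R.card → ∀ u, b ≤ ∑ v ∈ R, (meanCover P u R - meanCover P u (R.erase v)) := by
  intro R
  induction R using Finset.strongInduction with
  | H R ih =>
  intro hRA hR u
  refine h.le_of_harmonic_off (R := R)
    (f := fun u => ∑ v ∈ R, (meanCover P u R - meanCover P u (R.erase v)))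
    (Finset.card_pos.1 (by omega)) ?_ ?_ u
  · intro u hu
    have hsub : R.erase u ⊂ R := Finset.erase_ssubset hu
    -- A start in `R` is visited at time 0: its own term vanishes and the others form the sum for
    -- `R.erase u`.
    have hsplit : ∑ v ∈ R, (meanCover P u R - meanCover P u (R.erase v))
        = ∑ v ∈ R.erase u,
          (meanCover P u (R.erase u) - meanCover P u ((R.erase u).erase v)) := by
      rw [← Finset.add_sum_erase R _ hu, meanCover_erase, sub_self, zero_add]
      refine Finset.sum_congr rfl fun v _ => ?_
      rw [Finset.erase_right_comm, meanCover_erase]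
    rw [hsplit]
    have hcard := Finset.card_erase_of_mem hu
    by_cases h2 : 2 ≤ (R.erase u).card
    · exact ih _ hsub (hsub.subset.trans hRA) h2 u
    · obtain ⟨v, hv⟩ := Finset.card_eq_one.1 (show (R.erase u).card = 1 by omega)
      have hvR : v ∈ R.erase u := by rw [hv]; simp
      rw [hv, Finset.sum_singleton, Finset.erase_singleton,
        h.meanCover_of_erase_eq_empty (R := ∅) (by simp), sub_zero]
      exact hA u (hRA hu) v (hRA (Finset.mem_of_mem_erase hvR)) (Finset.ne_of_mem_erase hvR).symm
  · intro u hu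
    have hstep : ∀ S ⊆ R, S.Nonempty →
        meanCover P u S = 1 + ∑ w, P u w * meanCover P w S := by
      intro S hS hne
      have he : S.erase u = S := Finset.erase_eq_of_notMem fun hu' => hu (hS hu')
      rw [h.meanCover_eq (by rw [he]; exact hne.ne_empty), he]
    have hterm : ∀ v ∈ R, meanCover P u R - meanCover P u (R.erase v)
        = ∑ w, P u w * (meanCover P w R - meanCover P w (R.erase v)) := by
      intro v hv
      have hcard := Finset.card_erase_of_mem hv
      rw [hstep R subset_rfl (Finset.card_pos.1 (by omega)),
        hstep (R.erase v) (R.erase_subset v) (Finset.card_pos.1 (by omega))]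
      simp only [mul_sub, Finset.sum_sub_distrib]
      ring
    rw [Finset.sum_congr rfl hterm, Finset.sum_comm]
    simp only [Finset.mul_sum]

lemma meanCoverFrom_nonneg (h : IsPositiveChain P) {π : V → ℝ} (hπ : ∀ u, 0 ≤ π u)
    (R : Finset V) : 0 ≤ meanCoverFrom P π R :=
  Finset.sum_nonneg fun u _ => mul_nonneg (hπ u) (h.meanCover_nonneg _ _)

lemma meanCoverFrom_mono (h : IsPositiveChain P) {π : V → ℝ} (hπ : ∀ u, 0 ≤ π u)
    {R S : Finset V} (hRS : R ⊆ S) : meanCoverFrom P π R ≤ meanCoverFrom P π S :=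
  Finset.sum_le_sum fun u _ => mul_le_mul_of_nonneg_left (h.meanCover_mono u hRS) (hπ u)

/-- Matthews' lower bound for the cover time of a set. -/
lemma matthews_lower_bound (h : IsPositiveChain P) {π : V → ℝ} (hπ : ∀ u, 0 ≤ π u)
    (hπ1 : ∑ u, π u = 1) {A : Finset V} {b : ℝ} (hb : 0 ≤ b)
    (hA : ∀ u ∈ A, ∀ v ∈ A, u ≠ v → b ≤ meanCover P u {v}) :
    ∀ R ⊆ A, b * (Real.log R.card - 1) ≤ meanCoverFrom P π R := by
  -- Averaging the deletion inequality over `v` gains `b / |R|` per vertex, down to size 2; the term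
  -- for size 1 is lost.
  suffices H : ∀ R ⊆ A, b * ((harmonic R.card : ℝ) - 1) ≤ meanCoverFrom P π R by
    intro R hR
    rcases R.eq_empty_or_nonempty with rfl | hne
    · simp only [Finset.card_empty, Nat.cast_zero, Real.log_zero]
      linarith [h.meanCoverFrom_nonneg hπ (∅ : Finset V)]
    · refine le_trans ?_ (H R hR)
      have h1 := log_add_one_le_harmonic R.card
      have h2 : Real.log R.card ≤ Real.log ((R.card + 1 : ℕ) : ℝ) := by
        have : (0 : ℝ) < R.card := by exact_mod_cast hne.card_pos
        gcongr
        simp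
      gcongr
      linarith
  intro R
  induction R using Finset.strongInduction with
  | H R ih =>
  intro hRA
  by_cases hR : 2 ≤ R.card
  · have hpos : (0 : ℝ) < R.card := by exact_mod_cast (by omega : 0 < R.card)
    have h1 : b ≤ ∑ v ∈ R, (meanCoverFrom P π R - meanCoverFrom P π (R.erase v)) := by
      have h2 : ∑ u, π u * b ≤ ∑ u, π u *
          ∑ v ∈ R, (meanCover P u R - meanCover P u (R.erase v)) := by
        gcongr with u
        · exact hπ u
        · exact h.meanCover_sum_sub_ge hA R hRA hR u
      rw [← Finset.sum_mul, hπ1, one_mul] at h2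
      refine h2.trans_eq ?_
      simp only [meanCoverFrom, Finset.mul_sum, ← Finset.sum_sub_distrib, ← mul_sub]
      exact Finset.sum_comm
    have h3 : ∀ v ∈ R, meanCoverFrom P π R - meanCoverFrom P π (R.erase v)
        ≤ meanCoverFrom P π R - b * ((harmonic (R.card - 1) : ℝ) - 1) := by
      intro v hv
      have h4 := ih _ (Finset.erase_ssubset hv) ((R.erase_subset v).trans hRA)
      rw [Finset.card_erase_of_mem hv] at h4
      linarith
    have h5 := h1.trans (Finset.sum_le_sum h3)
    rw [Finset.sum_const, nsmul_eq_mul] at h5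
    have h6 : (harmonic R.card : ℝ) = (harmonic (R.card - 1) : ℝ) + 1 / R.card := by
      obtain ⟨m, hm⟩ : ∃ m, R.card = m + 1 := ⟨R.card - 1, by omega⟩
      rw [hm, Nat.add_sub_cancel, harmonic_succ]
      push_cast
      ring
    have h7 : b / R.card ≤ meanCoverFrom P π R - b * ((harmonic (R.card - 1) : ℝ) - 1) := by
      rw [div_le_iff₀ hpos]
      linarith
    rw [h6]
    calc b * ((harmonic (R.card - 1) : ℝ) + 1 / R.card - 1)
        = b / R.card + b * ((harmonic (R.card - 1) : ℝ) - 1) := by ring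
      _ ≤ _ := by linarith
  · have h0 := h.meanCoverFrom_nonneg hπ R
    have h1 : (harmonic R.card : ℝ) ≤ 1 := by
      have : R.card = 0 ∨ R.card = 1 := by omega
      rcases this with h | h <;> simp [h, harmonic]
    nlinarith

/-! ### Hitting time identities for reversible chains. -/

section Reversible

variable {π : V → ℝ}

lemma sum_reversible (h : IsPositiveChain P) (hrev : ∀ u w, π u * P u w = π w * P w u)
    (f : V → ℝ) : ∑ u, π u * ∑ w, P u w * f w = ∑ w, π w * f w := by
  simp only [Finset.mul_sum]
  rw [Finset.sum_comm]
  refine Finset.sum_congr rfl fun w _ => ?_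
  simp only [← mul_assoc, hrev _ w, ← Finset.sum_mul, ← Finset.mul_sum, h.sum_eq_one, mul_one]

/-- Off `a` this is the first-step equation. The value at `a`, Kac's return time formula, follows
because `f - P f` has `π`-mean zero. -/
lemma hit_sub_step (h : IsPositiveChain P) (hrev : ∀ u w, π u * P u w = π w * P w u)
    (hπ1 : ∑ u, π u = 1) (hπ : ∀ u, 0 < π u) (a u : V) :
    meanCover P u {a} - ∑ w, P u w * meanCover P w {a} = 1 - if u = a then 1 / π a else 0 := by
  by_cases hu : u = a
  · subst hu
    rw [if_pos rfl, h.hit_self]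
    have h1 : ∑ v, π v * (meanCover P v {u} - ∑ w, P v w * meanCover P w {u}) = 0 := by
      simp only [mul_sub, Finset.sum_sub_distrib]
      rw [h.sum_reversible hrev, sub_self]
    have h2 : ∑ v ∈ Finset.univ.erase u,
        π v * (meanCover P v {u} - ∑ w, P v w * meanCover P w {u}) = 1 - π u := by
      rw [← hπ1, ← Finset.add_sum_erase _ π (Finset.mem_univ u), add_sub_cancel_left]
      refine Finset.sum_congr rfl fun v hv => ?_
      rw [h.hit_eq (Finset.ne_of_mem_erase hv)]
      ring
    rw [← Finset.add_sum_erase _ _ (Finset.mem_univ u), h2, h.hit_self] at h1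
    have := (hπ u).ne'
    field_simp
    linarith
  · rw [if_neg hu, h.hit_eq hu]
    ring

/-- Self-adjointness of `I - P` in `L²(π)`, applied to the hitting time functions of `a` and `b`. -/
lemma hit_symm (h : IsPositiveChain P) (hrev : ∀ u w, π u * P u w = π w * P w u)
    (hπ1 : ∑ u, π u = 1) (hπ : ∀ u, 0 < π u) (a b : V) :
    meanCoverFrom P π {b} + meanCover P b {a} = meanCoverFrom P π {a} + meanCover P a {b} := by
  have key : ∀ a b : V, ∑ u, π u * ((meanCover P u {a} - ∑ w, P u w * meanCover P w {a})
      * meanCover P u {b}) = meanCoverFrom P π {b} - meanCover P a {b} := by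
    intro a b
    simp only [h.hit_sub_step hrev hπ1 hπ, sub_mul, one_mul, mul_sub, ite_mul, zero_mul, mul_ite,
      mul_zero, Finset.sum_sub_distrib, Finset.sum_ite_eq', Finset.mem_univ, if_true, meanCoverFrom]
    congr 1
    have := (hπ a).ne'
    field_simp
  have hsymm : ∑ u, π u * ((∑ w, P u w * meanCover P w {a}) * meanCover P u {b})
      = ∑ u, π u * ((∑ w, P u w * meanCover P w {b}) * meanCover P u {a}) := by
    simp only [Finset.mul_sum, Finset.sum_mul]
    rw [Finset.sum_comm]
    refine Finset.sum_congr rfl fun u _ => Finset.sum_congr rfl fun w _ => ?_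
    linear_combination (meanCover P u {a} * meanCover P w {b}) * hrev w u
  have h1 := key a b
  have h2 := key b a
  simp only [sub_mul, mul_sub, Finset.sum_sub_distrib] at h1 h2
  have h3 : ∑ u, π u * (meanCover P u {a} * meanCover P u {b})
      = ∑ u, π u * (meanCover P u {b} * meanCover P u {a}) := by
    simp only [mul_comm (meanCover P _ {a})]
  linarith

/-- The mean return time to `a` is `1 / π a`, and a detour through `b` can only take longer. -/
lemma commute_ge (h : IsPositiveChain P) (hrev : ∀ u w, π u * P u w = π w * P w u)
    (hπ1 : ∑ u, π u = 1) (hπ : ∀ u, 0 < π u) {a b : V} (hab : a ≠ b) :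
    1 / π a ≤ meanCover P a {b} + meanCover P b {a} := by
  have h1 := h.hit_sub_step hrev hπ1 hπ a a
  rw [if_pos rfl, h.hit_self] at h1
  have h2 : ∑ w, P a w * meanCover P w {a}
      ≤ ∑ w, P a w * (meanCover P w {b} + meanCover P b {a}) := by
    gcongr with w
    · exact h.nonneg a w
    · exact h.hit_triangle a b w
  simp only [mul_add, Finset.sum_add_distrib, ← Finset.sum_mul, h.sum_eq_one, one_mul] at h2
  have h3 := h.hit_eq hab
  linarith

end Reversible

end IsPositiveChain

end CoverFunction

/-! ### The `n log n` lower bound for one reversible chain. -/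

section LogBound

variable {V : Type*} [Fintype V] [DecidableEq V] {P : V → V → ℝ} {π : V → ℝ}

namespace IsPositiveChain

lemma half_le_meanCoverFrom (h : IsPositiveChain P) (hπ1 : ∑ u, π u = 1) (hπ : ∀ u, 0 < π u)
    (hV : 2 ≤ Fintype.card V) : 1 / 2 ≤ meanCoverFrom P π Finset.univ := by
  obtain ⟨v, hv⟩ : ∃ v, π v ≤ 1 / 2 := by
    by_contra! hlt
    obtain ⟨a, b, hab⟩ := Fintype.exists_pair_of_one_lt_card (show 1 < Fintype.card V by omega)
    have h1 : ∑ u ∈ ({a, b} : Finset V), π u ≤ ∑ u, π u :=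
      Finset.sum_le_sum_of_subset_of_nonneg (Finset.subset_univ _) fun u _ _ => (hπ u).le
    rw [Finset.sum_pair hab, hπ1] at h1
    linarith [hlt a, hlt b]
  have h1 : ∑ u, π u * (1 - if u = v then 1 else 0) ≤ meanCoverFrom P π {v} := by
    refine Finset.sum_le_sum fun u _ => mul_le_mul_of_nonneg_left ?_ (hπ u).le
    split_ifs with huv
    · simpa using h.meanCover_nonneg u {v}
    · rw [h.hit_eq huv]
      have := Finset.sum_nonneg fun w (_ : w ∈ Finset.univ) =>
        mul_nonneg (h.nonneg u w) (h.meanCover_nonneg w {v})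
      linarith
  simp only [mul_sub, mul_ite, mul_one, mul_zero, Finset.sum_sub_distrib, hπ1,
    Finset.sum_ite_eq', Finset.mem_univ, if_true] at h1
  linarith [h.meanCoverFrom_mono (fun u => (hπ u).le) (Finset.subset_univ {v})]

lemma half_card_le_card_light (hπ1 : ∑ u, π u = 1) (hπ : ∀ u, 0 < π u) :
    (Fintype.card V : ℝ) / 2
      ≤ (Finset.univ.filter fun v => π v ≤ 2 / (Fintype.card V : ℝ)).card := by
  rcases Nat.eq_zero_or_pos (Fintype.card V) with h0 | hpos
  · simp [h0]
  have hn : (0 : ℝ) < Fintype.card V := by exact_mod_cast hpos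
  set n : ℝ := (Fintype.card V : ℝ)
  have h1 : ∑ v ∈ Finset.univ.filter (fun v => ¬ π v ≤ 2 / n), 2 / n ≤ ∑ v, π v := by
    refine (Finset.sum_le_sum fun v hv => ?_).trans
      (Finset.sum_le_sum_of_subset_of_nonneg (Finset.filter_subset _ _) fun u _ _ => (hπ u).le)
    exact (not_le.1 (Finset.mem_filter.1 hv).2).le
  have h2 : ((Finset.univ.filter fun v => π v ≤ 2 / n).card : ℝ)
      + (Finset.univ.filter fun v => ¬ π v ≤ 2 / n).card = n := by
    rw [← Nat.cast_add, Finset.card_filter_add_card_filter_not, Finset.card_univ]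
  rw [Finset.sum_const, nsmul_eq_mul, hπ1, mul_div_assoc', div_le_iff₀ hn] at h1
  linarith

/-- Light vertices whose hitting times from stationarity nearly agree are far from each other. -/
lemma hit_ge_of_close (h : IsPositiveChain P) (hrev : ∀ u w, π u * P u w = π w * P w u)
    (hπ1 : ∑ u, π u = 1) (hπ : ∀ u, 0 < π u) {n : ℝ} (hn : 0 < n) {a b : V} (hab : a ≠ b)
    (ha : π a ≤ 2 / n)
    (hclose : |meanCoverFrom P π {a} - meanCoverFrom P π {b}| ≤ n / 4) :
    n / 8 ≤ meanCover P a {b} := by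
  have h1 := h.commute_ge hrev hπ1 hπ hab
  have h2 := h.hit_symm hrev hπ1 hπ a b
  have h3 : n / 2 ≤ 1 / π a := by
    rw [div_le_div_iff₀ two_pos (hπ a)]
    rw [le_div_iff₀ hn] at ha
    linarith
  rw [abs_le] at hclose
  linarith [hclose.1, hclose.2]

lemma cover_ge_of_large (h : IsPositiveChain P) (hrev : ∀ u w, π u * P u w = π w * P w u)
    (hπ1 : ∑ u, π u = 1) (hπ : ∀ u, 0 < π u) (hV : 33 ^ 4 ≤ Fintype.card V) :
    1 / 32 * ((Fintype.card V : ℝ) * Real.log (Fintype.card V))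
      ≤ meanCoverFrom P π Finset.univ := by
  have hπ0 : ∀ u, 0 ≤ π u := fun u => (hπ u).le
  have hlight := half_card_le_card_light hπ1 hπ
  have hn' : (33 : ℝ) ^ 4 ≤ Fintype.card V := by exact_mod_cast hV
  set n : ℝ := (Fintype.card V : ℝ)
  have hn : 0 < n := lt_of_lt_of_le (by positivity) hn'
  set W := Finset.univ.filter fun v => π v ≤ 2 / n
  -- With `y = n ^ (1/4)` there are at most `16 y + 1` classes, and `n / 2 = y ^ 4 / 2` light
  -- vertices force more than `⌊y ^ 2⌋` into one. This needs `16 y + 1 < y ^ 2 / 2`, which holds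
  -- from `y = 33` on.
  set y : ℝ := n ^ (1 / 4 : ℝ)
  have hy0 : 0 ≤ y := Real.rpow_nonneg hn.le _
  have hy4 : y ^ 4 = n := by
    rw [← Real.rpow_natCast, ← Real.rpow_mul hn.le]
    norm_num
  have hy : 33 ≤ y := le_of_pow_le_pow_left₀ (n := 4) (by norm_num) hy0 (by rw [hy4]; exact hn')
  have hlogy : Real.log n = 4 * Real.log y := by
    rw [← hy4, Real.log_pow]
    norm_num
  have hlog1 : 1 ≤ Real.log y := by
    rw [Real.le_log_iff_exp_le (by linarith)]
    linarith [Real.exp_one_lt_d9]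
  have hlogle : Real.log n ≤ 4 * y := by linarith [Real.log_le_self hy0]
  by_cases hB : n * Real.log n ≤ meanCoverFrom P π Finset.univ
  · have : 0 ≤ n * Real.log n := mul_nonneg hn.le (by linarith)
    linarith
  rw [not_le] at hB
  -- Classes of width `n / 4`, the tolerance in `hit_ge_of_close`.
  have hmaps : ∀ v ∈ W, ⌊4 * meanCoverFrom P π {v} / n⌋₊ ∈
      Finset.range (⌊4 * Real.log n⌋₊ + 1) := by
    intro v _
    rw [Finset.mem_range, Nat.lt_succ_iff]
    refine Nat.floor_mono ?_
    rw [div_le_iff₀ hn]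
    linarith [h.meanCoverFrom_mono hπ0 (Finset.subset_univ {v})]
  obtain ⟨j, -, hj⟩ := Finset.exists_lt_card_fiber_of_mul_lt_card_of_maps_to (n := ⌊y ^ 2⌋₊) hmaps
    (by
      rw [Finset.card_range]
      suffices (((⌊4 * Real.log n⌋₊ + 1) * ⌊y ^ 2⌋₊ : ℕ) : ℝ) < W.card by exact_mod_cast this
      push_cast
      refine lt_of_lt_of_le ?_ hlight
      have h1 : (⌊4 * Real.log n⌋₊ : ℝ) ≤ 16 * y :=
        (Nat.floor_le (by linarith)).trans (by linarith)
      have h2 : (⌊y ^ 2⌋₊ : ℝ) ≤ y ^ 2 := Nat.floor_le (by positivity)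
      calc ((⌊4 * Real.log n⌋₊ : ℝ) + 1) * ⌊y ^ 2⌋₊ ≤ (16 * y + 1) * y ^ 2 := by gcongr
        _ < y ^ 2 / 2 * y ^ 2 := by
          gcongr
          nlinarith
        _ = n / 2 := by rw [← hy4]; ring)
  set A := W.filter fun v => ⌊4 * meanCoverFrom P π {v} / n⌋₊ = j
  have hA : ∀ u ∈ A, ∀ v ∈ A, u ≠ v → n / 8 ≤ meanCover P u {v} := by
    intro u hu v hv huv
    obtain ⟨huW, huj⟩ := Finset.mem_filter.1 hu
    obtain ⟨-, hvj⟩ := Finset.mem_filter.1 hv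
    refine h.hit_ge_of_close hrev hπ1 hπ hn huv (Finset.mem_filter.1 huW).2 ?_
    have hnn : ∀ v : V, 0 ≤ 4 * meanCoverFrom P π {v} / n := fun v =>
      div_nonneg (mul_nonneg (by norm_num) (h.meanCoverFrom_nonneg hπ0 _)) hn.le
    obtain ⟨hu1, hu2⟩ := (Nat.floor_eq_iff (hnn u)).1 huj
    obtain ⟨hv1, hv2⟩ := (Nat.floor_eq_iff (hnn v)).1 hvj
    rw [le_div_iff₀ hn] at hu1 hv1
    rw [div_lt_iff₀ hn] at hu2 hv2
    rw [abs_le]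
    constructor <;> linarith
  have hmat := h.matthews_lower_bound hπ0 hπ1 (by positivity) hA A subset_rfl
  have hcard : 2 * Real.log y ≤ Real.log A.card := by
    have h1 : y ^ 2 ≤ A.card :=
      ((Nat.lt_floor_add_one (y ^ 2)).trans_le (by exact_mod_cast hj)).le
    calc 2 * Real.log y = Real.log (y ^ 2) := by rw [Real.log_pow]; norm_num
      _ ≤ _ := Real.log_le_log (by positivity) h1
  have hmono := h.meanCoverFrom_mono hπ0 (Finset.subset_univ A)
  have hfin : n / 8 * (Real.log n / 4) ≤ n / 8 * (Real.log A.card - 1) := by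
    gcongr
    linarith
  linarith

/-- The cover time of a reversible chain from stationarity is at least of order `n log n`. -/
lemma cover_ge (h : IsPositiveChain P) (hrev : ∀ u w, π u * P u w = π w * P w u)
    (hπ1 : ∑ u, π u = 1) (hπ : ∀ u, 0 < π u) (hV : 2 ≤ Fintype.card V) :
    1 / (2 * 33 ^ 8) * ((Fintype.card V : ℝ) * Real.log (Fintype.card V))
      ≤ meanCoverFrom P π Finset.univ := by
  have hn : (2 : ℝ) ≤ Fintype.card V := by exact_mod_cast hV
  have hlog : 0 ≤ Real.log (Fintype.card V) := Real.log_nonneg (by linarith)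
  by_cases hbig : 33 ^ 4 ≤ Fintype.card V
  · refine le_trans ?_ (h.cover_ge_of_large hrev hπ1 hπ hbig)
    gcongr
    norm_num
  · refine le_trans ?_ (h.half_le_meanCoverFrom hπ1 hπ hV)
    have h1 : (Fintype.card V : ℝ) ≤ 33 ^ 4 := by exact_mod_cast (not_le.1 hbig).le
    have h2 : Real.log (Fintype.card V) ≤ 33 ^ 4 :=
      (Real.log_le_self (by linarith)).trans h1
    calc 1 / (2 * 33 ^ 8) * ((Fintype.card V : ℝ) * Real.log (Fintype.card V))
        ≤ 1 / (2 * 33 ^ 8) * (33 ^ 4 * 33 ^ 4) := by gcongr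
      _ = 1 / 2 := by norm_num

end IsPositiveChain

end LogBound

/-! ### Comparing the restarted chain with one unrestarted walk. -/

section Restart

variable {V : Type*} [Fintype V] [DecidableEq V]

/-- The transition matrix `Q` modified so that at each step the chain restarts from the law `π` with
probability `l`. -/
def restart (Q : V → V → ℝ) (π : V → ℝ) (l : ℝ) (u w : V) : ℝ := (1 - l) * Q u w + l * π w

/-- The expectation of `φ (R \ D)`, where `D` is the set of vertices visited up to time `t` by the
chain with transition matrix `Q` started at `u`. -/
def residual (Q : V → V → ℝ) (φ : Finset V → ℝ) : ℕ → V → Finset V → ℝ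
  | 0, u, R => φ (R.erase u)
  | t + 1, u, R => ∑ w, Q u w * residual Q φ t w (R.erase u)

variable {Q : V → V → ℝ} {φ : Finset V → ℝ} {π : V → ℝ} {l : ℝ}

lemma residual_erase (t : ℕ) (u : V) (R : Finset V) :
    residual Q φ t u (R.erase u) = residual Q φ t u R := by
  cases t with
  | zero => rw [residual, residual, Finset.erase_idem]
  | succ t => rw [residual, residual, Finset.erase_idem]

lemma residual_nonneg (hQ : ∀ u w, 0 ≤ Q u w) (hφ : ∀ R, 0 ≤ φ R) (t : ℕ) (u : V)
    (R : Finset V) : 0 ≤ residual Q φ t u R := by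
  induction t generalizing u R with
  | zero => exact hφ _
  | succ t ih => exact Finset.sum_nonneg fun w _ => mul_nonneg (hQ u w) (ih _ _)

lemma sum_restart_mul (u : V) (f : V → ℝ) :
    ∑ w, restart Q π l u w * f w = (1 - l) * ∑ w, Q u w * f w + l * ∑ w, π w * f w := by
  simp only [restart, add_mul, Finset.sum_add_distrib, Finset.mul_sum, mul_assoc]

lemma isPositiveChain_restart (hQ : ∀ u w, 0 ≤ Q u w) (hQ1 : ∀ u, ∑ w, Q u w = 1)
    (hπ : ∀ u, 0 < π u) (hπ1 : ∑ u, π u = 1) (hl : 0 < l) (hl1 : l ≤ 1) :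
    IsPositiveChain (restart Q π l) where
  pos u w := add_pos_of_nonneg_of_pos (mul_nonneg (by linarith) (hQ u w)) (mul_pos hl (hπ w))
  sum_eq_one u := by
    have := sum_restart_mul (Q := Q) (π := π) (l := l) u fun _ => 1
    simp only [mul_one, hQ1, hπ1] at this
    linarith

lemma restart_reversible (hrev : ∀ u w, π u * Q u w = π w * Q w u) (u w : V) :
    π u * restart Q π l u w = π w * restart Q π l w u := by
  simp only [restart]
  linear_combination (1 - l) * hrev u w

namespace IsPositiveChain

/-- After a mean time of at most `1 / l` the restarted chain has forgotten its initial vertex. -/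
lemma meanCover_restart_le (h : IsPositiveChain (restart Q π l)) (hQ : ∀ u w, 0 ≤ Q u w)
    (hQ1 : ∀ u, ∑ w, Q u w = 1) (hπ : ∀ u, 0 ≤ π u) (hl : 0 < l) (hl1 : l ≤ 1)
    (u : V) (R : Finset V) :
    meanCover (restart Q π l) u R ≤ 1 / l + meanCoverFrom (restart Q π l) π (R.erase u) := by
  suffices H : ∀ T, cappedCover (restart Q π l) T u R
      ≤ 1 / l + meanCoverFrom (restart Q π l) π (R.erase u) from ciSup_le H
  intro T
  induction T generalizing u R with
  | zero => exact add_nonneg (by positivity) (h.meanCoverFrom_nonneg hπ _)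
  | succ T ih =>
    rw [cappedCover]
    split_ifs with hR
    · exact add_nonneg (by positivity) (h.meanCoverFrom_nonneg hπ _)
    · rw [sum_restart_mul]
      set B := meanCoverFrom (restart Q π l) π (R.erase u)
      have h1 : ∑ w, Q u w * cappedCover (restart Q π l) T w (R.erase u)
          ≤ ∑ w, Q u w * (1 / l + B) := by
        gcongr with w
        · exact hQ u w
        · refine (ih w (R.erase u)).trans ?_
          gcongr
          exact h.meanCoverFrom_mono hπ (Finset.erase_subset _ _)
      rw [← Finset.sum_mul, hQ1, one_mul] at h1
      have h2 : ∑ w, π w * cappedCover (restart Q π l) T w (R.erase u) ≤ B :=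
        Finset.sum_le_sum fun w _ =>
          mul_le_mul_of_nonneg_left (le_ciSup (h.bddAbove w _) T) (hπ w)
      have h3 := mul_le_mul_of_nonneg_left h1 (sub_nonneg.2 hl1)
      have h4 := mul_le_mul_of_nonneg_left h2 hl.le
      have h5 : (1 - l) * (1 / l + B) = 1 / l + B - 1 - l * B := by
        field_simp
        ring
      linarith

/-- With probability `(1 - l) ^ t` the first `t` steps contain no restart, and only the residual set
remains. Otherwise the chain starts afresh from `π` with at most `R` to cover. The wait for the
first restart costs `1 / l` in either case. -/
lemma meanCover_le_residual (h : IsPositiveChain (restart Q π l)) (hQ : ∀ u w, 0 ≤ Q u w)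
    (hQ1 : ∀ u, ∑ w, Q u w = 1) (hπ : ∀ u, 0 ≤ π u) (hl : 0 < l) (hl1 : l ≤ 1)
    (t : ℕ) (u : V) (R : Finset V) :
    meanCover (restart Q π l) u R ≤ 1 / l
      + (1 - l) ^ t * residual Q (meanCoverFrom (restart Q π l) π) t u R
      + (1 - (1 - l) ^ t) * meanCoverFrom (restart Q π l) π R := by
  induction t generalizing u R with
  | zero => simpa [residual] using h.meanCover_restart_le hQ hQ1 hπ hl hl1 u R
  | succ t ih =>
    refine (h.meanCover_le u R).trans ?_
    rw [sum_restart_mul, residual]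
    set B := meanCoverFrom (restart Q π l) π
    have hB : B (R.erase u) ≤ B R := h.meanCoverFrom_mono hπ (Finset.erase_subset _ _)
    set q := (1 - l) ^ t
    have hq1 : q ≤ 1 := pow_le_one₀ (by linarith) (by linarith)
    have h1 : ∑ w, Q u w * meanCover (restart Q π l) w (R.erase u)
        ≤ ∑ w, Q u w * (1 / l + q * residual Q B t w (R.erase u) + (1 - q) * B R) := by
      gcongr with w
      · exact hQ u w
      · refine (ih w (R.erase u)).trans ?_
        gcongr
    have h2 : ∑ w, Q u w * (1 / l + q * residual Q B t w (R.erase u) + (1 - q) * B R)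
        = 1 / l + q * ∑ w, Q u w * residual Q B t w (R.erase u) + (1 - q) * B R := by
      simp only [mul_add, Finset.sum_add_distrib, ← Finset.sum_mul, hQ1, one_mul, Finset.mul_sum,
        mul_left_comm]
    have h3 := mul_le_mul_of_nonneg_left (h1.trans_eq h2) (sub_nonneg.2 hl1)
    have h4 : l * ∑ w, π w * meanCover (restart Q π l) w (R.erase u) ≤ l * B R :=
      mul_le_mul_of_nonneg_left hB hl.le
    have h5 : (1 - l) * (1 / l) = 1 / l - 1 := by
      field_simp
    have hqs : (1 - l) ^ (t + 1) = q * (1 - l) := pow_succ _ _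
    rw [hqs]
    linear_combination h3 + h4 + h5

/-- One walk of length `t` reduces the cover time of the restarted chain by at most a term of order
`1 / l`. -/
lemma meanCoverFrom_le_residual (h : IsPositiveChain (restart Q π l)) (hQ : ∀ u w, 0 ≤ Q u w)
    (hQ1 : ∀ u, ∑ w, Q u w = 1) (hπ : ∀ u, 0 ≤ π u) (hπ1 : ∑ u, π u = 1) (hl : 0 < l)
    (hl1 : l ≤ 1) {t : ℕ} (hq : 0 < (1 - l) ^ t) (R : Finset V) :
    meanCoverFrom (restart Q π l) π R ≤ 1 / (l * (1 - l) ^ t)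
      + ∑ u, π u * residual Q (meanCoverFrom (restart Q π l) π) t u R := by
  set B := meanCoverFrom (restart Q π l) π with hB
  set q := (1 - l) ^ t
  set S := ∑ u, π u * residual Q B t u R with hS
  have h1 : B R ≤ ∑ u, π u * (1 / l + q * residual Q B t u R + (1 - q) * B R) := by
    rw [hB]
    exact Finset.sum_le_sum fun u _ => mul_le_mul_of_nonneg_left
      (h.meanCover_le_residual hQ hQ1 hπ hl hl1 t u R) (hπ u)
  have h2 : ∑ u, π u * (1 / l + q * residual Q B t u R + (1 - q) * B R)
      = 1 / l + q * S + (1 - q) * B R := by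
    rw [hS]
    simp only [mul_add, Finset.sum_add_distrib, ← Finset.sum_mul, hπ1, one_mul, Finset.mul_sum,
      mul_left_comm]
  rw [h2] at h1
  have h3 : 1 / (l * q) = 1 / l / q := by rw [div_div]
  -- The term `(1 - q) * B R` is absorbed on the left and the inequality divided by `q`.
  rw [h3, ← sub_le_iff_le_add, le_div_iff₀ hq]
  linarith

end IsPositiveChain

end Restart

/-! ### The Markov property for the trajectory measure. -/

section Trajectories

variable {V : Type*} [Fintype V] [DecidableEq V] [MeasurableSpace V] [DiscreteMeasurableSpace V]
  {P : V → PMF V} {μ : Measure V} [IsProbabilityMeasure μ]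

instance : IsProbabilityMeasure (chainLaw P μ) :=
  inferInstanceAs (IsProbabilityMeasure (Kernel.trajMeasure (X := fun _ => V) μ (historyKernel P)))

lemma lintegral_chainLaw_zero (f : V → ℝ≥0∞) :
    ∫⁻ X, f (X 0) ∂(chainLaw P μ) = ∫⁻ u, f u ∂μ := by
  have hmap : (chainLaw P μ).map (Preorder.frestrictLe (π := fun _ : ℕ => V) 0)
      = μ.map (MeasurableEquiv.piUnique fun _ : Finset.Iic 0 => V).symm := by
    rw [chainLaw, Kernel.trajMeasure, Measure.map_comp _ _ (by fun_prop),
      Kernel.traj_map_frestrictLe, Kernel.partialTraj_self, Measure.id_comp]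
  calc ∫⁻ X, f (X 0) ∂(chainLaw P μ)
      = ∫⁻ p, f (p ⟨0, Finset.mem_Iic.2 le_rfl⟩)
          ∂((chainLaw P μ).map (Preorder.frestrictLe (π := fun _ : ℕ => V) 0)) := by
        rw [lintegral_map (by fun_prop) (by fun_prop)]
        rfl
    _ = ∫⁻ u, f u ∂μ := by
        rw [hmap, lintegral_map (by fun_prop) (by fun_prop)]
        rfl

/-- `F` sees the whole history because the visited set depends on all of it. -/
lemma lintegral_chainLaw_succ (r : ℕ) (F : ((_ : Finset.Iic r) → V) → V → ℝ≥0∞) :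
    ∫⁻ X, F (Preorder.frestrictLe r X) (X (r + 1)) ∂(chainLaw P μ)
      = ∫⁻ X, ∑ w, P (X r) w * F (Preorder.frestrictLe r X) w ∂(chainLaw P μ) := by
  have hmap := Kernel.map_frestrictLe_trajMeasure_compProd_eq_map_trajMeasure
    (X := fun _ => V) (μ₀ := μ) (κ := historyKernel P) (a := r)
  have hF : Measurable fun p : ((_ : Finset.Iic r) → V) × V => F p.1 p.2 := .of_discrete
  calc ∫⁻ X, F (Preorder.frestrictLe r X) (X (r + 1)) ∂(chainLaw P μ)
      = ∫⁻ p, F p.1 p.2 ∂((chainLaw P μ).map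
          fun X => (Preorder.frestrictLe (π := fun _ : ℕ => V) r X, X (r + 1))) := by
        rw [lintegral_map hF (by fun_prop)]
    _ = ∫⁻ p, ∑ w, P (p ⟨r, Finset.mem_Iic.2 le_rfl⟩) w * F p w
          ∂((chainLaw P μ).map (Preorder.frestrictLe (π := fun _ : ℕ => V) r)) := by
        rw [chainLaw, ← hmap, Measure.lintegral_compProd hF]
        refine lintegral_congr fun p => ?_
        rw [lintegral_fintype]
        refine Finset.sum_congr rfl fun w _ => ?_
        rw [mul_comm]
        congr 1
        exact PMF.toMeasure_apply_singleton _ _ (.of_discrete)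
    _ = _ := by
        rw [lintegral_map .of_discrete (by fun_prop)]
        rfl

/-- The set of vertices visited by a trajectory up to time `t`. -/
def visited (t : ℕ) (X : ℕ → V) : Finset V := (Finset.range (t + 1)).image X

lemma visited_eq_image_frestrictLe (t : ℕ) (X : ℕ → V) :
    visited t X = Finset.univ.image (Preorder.frestrictLe (π := fun _ : ℕ => V) t X) := by
  ext v
  simp only [visited, Finset.mem_image, Finset.mem_range, Finset.mem_univ, true_and,
    Subtype.exists, Finset.mem_Iic, Nat.lt_succ_iff]
  constructor
  · rintro ⟨s, hs, rfl⟩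
    exact ⟨s, hs, rfl⟩
  · rintro ⟨s, hs, rfl⟩
    exact ⟨s, hs, rfl⟩

lemma visited_succ (t : ℕ) (X : ℕ → V) :
    visited (t + 1) X = insert (X (t + 1)) (visited t X) := by
  rw [visited, Finset.range_add_one, Finset.image_insert]
  rfl

lemma measurable_visited [MeasurableSpace (Finset V)] (t : ℕ) :
    Measurable (visited t : (ℕ → V) → Finset V) := by
  have : (visited t : (ℕ → V) → Finset V) = (fun p => Finset.univ.image p) ∘
      Preorder.frestrictLe (π := fun _ : ℕ => V) t :=
    funext fun X => visited_eq_image_frestrictLe t X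
  rw [this]
  exact (Measurable.of_discrete).comp (by fun_prop)

lemma sdiff_visited_succ (t : ℕ) (X : ℕ → V) (R : Finset V) :
    R \ visited (t + 1) X = (R \ visited t X).erase (X (t + 1)) := by
  rw [visited_succ, Finset.sdiff_insert]

variable {φ : Finset V → ℝ}

lemma residual_ofReal_step (hφ : ∀ R, 0 ≤ φ R) (t : ℕ) (u : V) {R : Finset V} (hu : u ∉ R) :
    ENNReal.ofReal (residual (fun u w => (P u w).toReal) φ (t + 1) u R)
      = ∑ w, P u w * ENNReal.ofReal (residual (fun u w => (P u w).toReal) φ t w (R.erase w)) := by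
  have hQ : ∀ u w, 0 ≤ (P u w).toReal := fun _ _ => ENNReal.toReal_nonneg
  rw [residual, Finset.erase_eq_of_notMem hu, ENNReal.ofReal_sum_of_nonneg fun w _ =>
    mul_nonneg (hQ u w) (residual_nonneg hQ hφ _ _ _)]
  refine Finset.sum_congr rfl fun w _ => ?_
  rw [ENNReal.ofReal_mul (hQ u w), ENNReal.ofReal_toReal (PMF.apply_ne_top _ _), residual_erase]

lemma notMem_sdiff_visited (t : ℕ) (X : ℕ → V) (R : Finset V) : X t ∉ R \ visited t X := by
  simp only [Finset.mem_sdiff, not_and, not_not, visited]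
  exact fun _ => Finset.mem_image_of_mem X (by simp)

/-- The Markov property for functionals of the visited set. -/
lemma lintegral_residual (hφ : ∀ R, 0 ≤ φ R) (R : Finset V) (r s : ℕ) :
    ∫⁻ X, ENNReal.ofReal (residual (fun u w => (P u w).toReal) φ s (X r) (R \ visited r X))
        ∂(chainLaw P μ)
      = ∫⁻ u, ENNReal.ofReal (residual (fun u w => (P u w).toReal) φ (r + s) u R) ∂μ := by
  induction r generalizing s with
  | zero =>
    rw [← lintegral_chainLaw_zero (P := P)]
    refine lintegral_congr fun X => ?_
    have : R \ visited 0 X = R.erase (X 0) := by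
      simp [visited, Finset.sdiff_singleton_eq_erase]
    rw [this, residual_erase, zero_add]
  | succ r ih =>
    rw [show r + 1 + s = r + (s + 1) by ring, ← ih (s + 1)]
    simp only [sdiff_visited_succ]
    simp only [visited_eq_image_frestrictLe]
    rw [lintegral_chainLaw_succ r fun p w => ENNReal.ofReal
      (residual (fun u w => (P u w).toReal) φ s w ((R \ Finset.univ.image p).erase w))]
    simp only [← visited_eq_image_frestrictLe]
    exact lintegral_congr fun X => (residual_ofReal_step hφ s _ (notMem_sdiff_visited r X R)).symm

lemma lintegral_sdiff_visited (hφ : ∀ R, 0 ≤ φ R) (R : Finset V) (t : ℕ) :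
    ∫⁻ X, ENNReal.ofReal (φ (R \ visited t X)) ∂(chainLaw P μ)
      = ∫⁻ u, ENNReal.ofReal (residual (fun u w => (P u w).toReal) φ t u R) ∂μ := by
  rw [← add_zero t, ← lintegral_residual hφ R t 0, add_zero]
  refine lintegral_congr fun X => ?_
  rw [residual, Finset.erase_eq_of_notMem (notMem_sdiff_visited t X R)]

end Trajectories

/-! ### Iterating an inequality over independent samples. -/

section Product

variable {V Ω : Type*} [Finite V] [DecidableEq V] [MeasurableSpace (Finset V)]
  [DiscreteMeasurableSpace (Finset V)] [MeasurableSpace Ω] {ν : Measure Ω} [IsProbabilityMeasure ν]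

/-- Since `hΦ` holds for every set, it applies to the random set left by the first `k` samples;
independence lets Fubini add a fresh one. -/
lemma le_lintegral_pi_sdiff_biUnion {D : Ω → Finset V} (hD : Measurable D)
    {Φ : Finset V → ℝ≥0∞} {a : ℝ≥0∞} (hΦ : ∀ R, Φ R ≤ a + ∫⁻ ω, Φ (R \ D ω) ∂ν) (k : ℕ)
    (R : Finset V) :
    Φ R ≤ k * a + ∫⁻ ω, Φ (R \ Finset.univ.biUnion fun i => D (ω i))
      ∂(Measure.pi fun _ : Fin k => ν) := by
  induction k with
  | zero => simp
  | succ k ih =>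
    have hU : Measurable fun ω : Fin k → Ω => Finset.univ.biUnion fun i => D (ω i) :=
      (Measurable.of_discrete (f := fun S : Fin k → Finset V => Finset.univ.biUnion S)).comp
        (measurable_pi_lambda _ fun i => hD.comp (measurable_pi_apply i))
    have hg : Measurable fun p : Ω × (Fin k → Ω) =>
        Φ ((R \ Finset.univ.biUnion fun i => D (p.2 i)) \ D p.1) :=
      (Measurable.of_discrete (f := fun S : Finset V × Finset V => Φ ((R \ S.2) \ S.1))).comp
        ((hD.comp measurable_fst).prodMk (hU.comp measurable_snd))
    have hpi := (measurePreserving_piFinSuccAbove (fun _ : Fin (k + 1) => ν) 0).lintegral_comp hg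
    rw [lintegral_prod_symm' _ hg] at hpi
    have hsplit : ∀ ω : Fin (k + 1) → Ω,
        (R \ Finset.univ.biUnion fun i => D (ω i))
          = (R \ Finset.univ.biUnion fun i : Fin k => D (ω i.succ)) \ D (ω 0) := by
      intro ω
      ext v
      simp [Fin.forall_fin_succ]
      tauto
    calc Φ R ≤ k * a + ∫⁻ ω, Φ (R \ Finset.univ.biUnion fun i => D (ω i))
            ∂(Measure.pi fun _ : Fin k => ν) := ih
      _ ≤ k * a + ∫⁻ ω, (a + ∫⁻ ω', Φ ((R \ Finset.univ.biUnion fun i => D (ω i)) \ D ω') ∂ν)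
            ∂(Measure.pi fun _ : Fin k => ν) := by
          gcongr
          exact hΦ _
      _ = (k + 1 : ℕ) * a + ∫⁻ ω, Φ (R \ Finset.univ.biUnion fun i => D (ω i))
            ∂(Measure.pi fun _ : Fin (k + 1) => ν) := by
          rw [lintegral_add_left measurable_const, lintegral_const, measure_univ, mul_one, ← hpi]
          simp only [hsplit]
          push_cast
          rw [add_mul, one_mul, add_assoc]
          rfl

end Product

/-! ### From `k` walks to the restarted chain. -/

section Reversible

variable {V : Type*} [Fintype V] [DecidableEq V] [MeasurableSpace V] [DiscreteMeasurableSpace V]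

lemma le_coverTime {k t : ℕ} {X : Fin k → ℕ → V}
    (h : (Finset.univ \ Finset.univ.biUnion fun i => visited t (X i)) ≠ (∅ : Finset V)) :
    (t : ℝ≥0∞) + 1 ≤ coverTime X := by
  refine le_iInf₂ fun s hs => ?_
  obtain ⟨v, hv⟩ := Finset.nonempty_iff_ne_empty.2 h
  simp only [Finset.mem_sdiff, Finset.mem_univ, true_and, Finset.mem_biUnion, not_exists,
    visited, Finset.mem_image, Finset.mem_range, not_and] at hv
  obtain ⟨i, r, hr, hX⟩ := hs v
  have : ¬ r < t + 1 := fun hrt => hv i r hrt hX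
  exact_mod_cast (by omega : t + 1 ≤ s)

/-- The power is `(1 + 1 / t) ^ (-t) ≥ 1 / e` for `t ≥ 1`. -/
lemma one_third_le_pow (t : ℕ) : (1 / 3 : ℝ) ≤ (1 - 1 / ((t : ℝ) + 1)) ^ t := by
  rcases Nat.eq_zero_or_pos t with rfl | ht
  · norm_num
  have ht' : (0 : ℝ) < t := by exact_mod_cast ht
  have h1 : (1 + 1 / (t : ℝ)) ^ t ≤ 3 := by
    calc (1 + 1 / (t : ℝ)) ^ t ≤ Real.exp (1 / t) ^ t := by
          gcongr
          linarith [Real.add_one_le_exp (1 / (t : ℝ))]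
      _ = Real.exp 1 := by
          rw [← Real.exp_nat_mul]
          congr 1
          field_simp
      _ ≤ 3 := by linarith [Real.exp_one_lt_d9]
  have h2 : 1 - 1 / ((t : ℝ) + 1) = (1 + 1 / (t : ℝ))⁻¹ := by
    field_simp
    ring
  rw [h2, inv_pow, one_div]
  exact inv_anti₀ (by positivity) h1

lemma sum_toReal_eq_one (p : PMF V) : ∑ w, (p w).toReal = 1 := by
  have h := p.tsum_coe
  rw [tsum_fintype] at h
  rw [← ENNReal.toReal_sum fun w _ => PMF.apply_ne_top _ _, h, ENNReal.toReal_one]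

variable {P : V → PMF V} {π : V → ℝ}

/-- If `k` walks from stationarity of length `t` are likely to cover, then the walk that restarts
after a mean time of `t + 1` covers within a mean time of order `k * (t + 1)`. -/
lemma meanCoverFrom_restart_le (hπ : ∀ u, 0 < π u) (hπ1 : ∑ u, π u = 1) {t k : ℕ}
    (hE : 2 * expectedCoverTime P (∑ v, ENNReal.ofReal (π v) • Measure.dirac v) k ≤ t + 1) :
    meanCoverFrom (restart (fun u w => (P u w).toReal) π (1 / ((t : ℝ) + 1))) π Finset.univ
      ≤ 6 * k * (t + 1) := by
  set μ : Measure V := ∑ v, ENNReal.ofReal (π v) • Measure.dirac v with hμ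
  have hπ0 : ∀ u, 0 ≤ π u := fun u => (hπ u).le
  have hprob : IsProbabilityMeasure μ := by
    constructor
    simp only [hμ, Measure.coe_finsetSum, Finset.sum_apply, Measure.smul_apply, measure_univ,
      smul_eq_mul, mul_one]
    rw [← ENNReal.ofReal_sum_of_nonneg fun u _ => hπ0 u, hπ1, ENNReal.ofReal_one]
  have ht : (0 : ℝ) < (t : ℝ) + 1 := by positivity
  set l : ℝ := 1 / ((t : ℝ) + 1) with hldef
  have hl : 0 < l := by positivity
  have hl1 : l ≤ 1 := by
    rw [hldef, div_le_one ht]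
    linarith [(Nat.cast_nonneg t : (0 : ℝ) ≤ t)]
  have hq3 : (1 / 3 : ℝ) ≤ (1 - l) ^ t := one_third_le_pow t
  have hq : 0 < (1 - l) ^ t := by linarith
  set Q : V → V → ℝ := fun u w => (P u w).toReal
  have hQ : ∀ u w, 0 ≤ Q u w := fun _ _ => ENNReal.toReal_nonneg
  have hQ1 : ∀ u, ∑ w, Q u w = 1 := fun u => sum_toReal_eq_one (P u)
  have h := isPositiveChain_restart hQ hQ1 hπ hπ1 hl hl1
  set B := meanCoverFrom (restart Q π l) π with hB
  have hB0 : ∀ R, 0 ≤ B R := h.meanCoverFrom_nonneg hπ0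
  have hBempty : B ∅ = 0 := by
    simp only [hB, meanCoverFrom]
    exact Finset.sum_eq_zero fun u _ => by
      rw [h.meanCover_of_erase_eq_empty (by simp), mul_zero]
  -- Bounds `1 / (l * (1 - l) ^ t)`, by `one_third_le_pow`.
  set a : ℝ := 3 * (t + 1)
  have hstep : ∀ R, ENNReal.ofReal (B R) ≤ ENNReal.ofReal a
      + ∫⁻ X, ENNReal.ofReal (B (R \ visited t X)) ∂(chainLaw P μ) := by
    intro R
    have hres : ∀ u, 0 ≤ residual Q B t u R := fun u => residual_nonneg hQ hB0 t u R
    rw [lintegral_sdiff_visited hB0 R t, hμ, lintegral_finsetSum_measure]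
    simp only [lintegral_smul_measure, lintegral_dirac, smul_eq_mul]
    simp only [← ENNReal.ofReal_mul (hπ0 _)]
    rw [← ENNReal.ofReal_sum_of_nonneg fun u _ => mul_nonneg (hπ0 u) (hres u),
      ← ENNReal.ofReal_add (by positivity)
        (Finset.sum_nonneg fun u _ => mul_nonneg (hπ0 u) (hres u))]
    refine ENNReal.ofReal_le_ofReal
      ((h.meanCoverFrom_le_residual hQ hQ1 hπ0 hπ1 hl hl1 hq R).trans ?_)
    gcongr
    rw [div_le_iff₀ (mul_pos hl hq), hldef]
    have : a * (1 / ((t : ℝ) + 1) * (1 - 1 / ((t : ℝ) + 1)) ^ t)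
        = 3 * (1 - l) ^ t := by
      rw [← hldef]
      simp only [a, hldef]
      field_simp
    linarith
  let _ : MeasurableSpace (Finset V) := ⊤
  have hk := le_lintegral_pi_sdiff_biUnion (ν := chainLaw P μ) (measurable_visited t) hstep k
    Finset.univ
  -- Markov's inequality: the integrand vanishes once all is covered, and otherwise is at most `B V`
  -- while the cover time is at least `t + 1`.
  have hhalf : ∫⁻ X, ENNReal.ofReal (B (Finset.univ \ Finset.univ.biUnion fun i => visited t (X i)))
      ∂(Measure.pi fun _ : Fin k => chainLaw P μ) ≤ ENNReal.ofReal (B Finset.univ / 2) := by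
    set b := ENNReal.ofReal (B Finset.univ / (2 * (t + 1)))
    calc _ ≤ ∫⁻ X, b * (2 * coverTime X) ∂(Measure.pi fun _ : Fin k => chainLaw P μ) := by
          refine lintegral_mono fun X => ?_
          by_cases hX : (Finset.univ \ Finset.univ.biUnion fun i => visited t (X i))
              = (∅ : Finset V)
          · simp [hX, hBempty]
          · calc _ ≤ ENNReal.ofReal (B Finset.univ) :=
                  ENNReal.ofReal_le_ofReal (h.meanCoverFrom_mono hπ0 (Finset.subset_univ _))
              _ = b * (2 * ((t : ℝ≥0∞) + 1)) := by
                  have : (2 * ((t : ℝ≥0∞) + 1)) = ENNReal.ofReal (2 * (t + 1)) := by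
                    rw [ENNReal.ofReal_mul (by norm_num), ENNReal.ofReal_add (by positivity)
                      (by norm_num)]
                    simp
                  rw [this, ← ENNReal.ofReal_mul (div_nonneg (hB0 _) (by positivity))]
                  congr 1
                  field_simp
              _ ≤ b * (2 * coverTime X) := by
                  gcongr
                  exact le_coverTime hX
      _ = b * (2 * expectedCoverTime P μ k) := by
          rw [lintegral_const_mul' _ _ ENNReal.ofReal_ne_top,
            lintegral_const_mul' _ _ (by norm_num)]
          rfl
      _ ≤ b * ENNReal.ofReal (t + 1) := by
          gcongr
          refine hE.trans_eq ?_
          rw [ENNReal.ofReal_add (by positivity) (by norm_num)]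
          simp
      _ = ENNReal.ofReal (B Finset.univ / 2) := by
          rw [← ENNReal.ofReal_mul (div_nonneg (hB0 _) (by positivity))]
          congr 1
          field_simp
  have hfin : ENNReal.ofReal (B Finset.univ) ≤ ENNReal.ofReal (k * a + B Finset.univ / 2) := by
    rw [ENNReal.ofReal_add (by positivity) (by linarith [hB0 Finset.univ]),
      ENNReal.ofReal_mul (by positivity), ENNReal.ofReal_natCast]
    exact hk.trans (add_le_add le_rfl hhalf)
  rw [ENNReal.ofReal_le_ofReal_iff (add_nonneg (by positivity) (by linarith [hB0 Finset.univ]))]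
    at hfin
  simp only [a] at hfin
  linarith

/-- The lower bound for the cover time of `k` independent copies of a reversible chain. -/
lemma expectedCoverTime_ge (hπ : ∀ u, 0 < π u) (hπ1 : ∑ u, π u = 1)
    (hrev : ∀ u w, π u * (P u w).toReal = π w * (P w u).toReal) {k : ℕ} (hk : 1 ≤ k)
    (hV : 2 ≤ Fintype.card V)
    (hkn : (k : ℝ) ≤ 1 / (72 * 33 ^ 8) * ((Fintype.card V : ℝ) * Real.log (Fintype.card V))) :
    ENNReal.ofReal (1 / (72 * 33 ^ 8) * ((Fintype.card V : ℝ) / k) * Real.log (Fintype.card V))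
      ≤ expectedCoverTime P (∑ v, ENNReal.ofReal (π v) • Measure.dirac v) k := by
  by_contra! hlt
  have hk0 : (0 : ℝ) < k := by exact_mod_cast hk
  set L : ℝ := (Fintype.card V : ℝ) * Real.log (Fintype.card V)
  set x : ℝ := 1 / (72 * 33 ^ 8) * ((Fintype.card V : ℝ) / k) * Real.log (Fintype.card V)
  have hx : k * x = 1 / (72 * 33 ^ 8) * L := by
    simp only [x, L]
    field_simp
  -- The upper bound on `k` enters here; it lets `t + 1 ≤ 2 x + 1` be replaced by `3 x`.
  have hx1 : 1 ≤ x := by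
    by_contra! hx1
    have := mul_lt_mul_of_pos_left hx1 hk0
    linarith
  set t := ⌊2 * x⌋₊
  have ht1 : 2 * x ≤ t + 1 := (Nat.lt_floor_add_one _).le
  have ht2 : (t : ℝ) ≤ 2 * x := Nat.floor_le (by linarith)
  have hE : 2 * expectedCoverTime P (∑ v, ENNReal.ofReal (π v) • Measure.dirac v) k
      ≤ (t : ℝ≥0∞) + 1 := by
    calc _ ≤ 2 * ENNReal.ofReal x := by gcongr
      _ = ENNReal.ofReal (2 * x) := by
          rw [ENNReal.ofReal_mul (p := 2) (q := x) two_pos.le, ENNReal.ofReal_ofNat]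
      _ ≤ ENNReal.ofReal (t + 1) := ENNReal.ofReal_le_ofReal ht1
      _ = _ := by
          rw [ENNReal.ofReal_add (by positivity) (by norm_num)]
          simp
  have hup := meanCoverFrom_restart_le hπ hπ1 hE
  have hchain := isPositiveChain_restart (Q := fun u w => (P u w).toReal)
    (l := 1 / ((t : ℝ) + 1)) (fun _ _ => ENNReal.toReal_nonneg) (fun u => sum_toReal_eq_one (P u)) hπ hπ1 (by positivity)
    (by
      rw [div_le_one (by positivity)]
      linarith [(Nat.cast_nonneg t : (0 : ℝ) ≤ t)])
  have hlow := hchain.cover_ge (restart_reversible hrev) hπ1 hπ hV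
  -- As `18 / 72 = 1 / 4`, this falls strictly below the constant `1 / (2 * 33 ^ 8)` of `cover_ge`.
  have hkx : 6 * k * ((t : ℝ) + 1) ≤ 18 * (k * x) := by nlinarith
  rw [hx] at hkx
  have hL : 0 < L := by
    have : 0 < k * x := mul_pos hk0 (by linarith)
    rw [hx] at this
    exact (mul_pos_iff_of_pos_left (by norm_num)).1 this
  linarith

end Reversible

/-! ### Transition probabilities and reversibility on graphs. -/

section Graph

variable {V : Type*} [Fintype V] (G : SimpleGraph V) [DecidableRel G.Adj]

lemma simpleStep_toReal (hdeg : ∀ u, 0 < G.degree u) (u w : V) :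
    (simpleStep G u w).toReal = if G.Adj u w then ((G.degree u : ℝ))⁻¹ else 0 := by
  have h : (G.neighborFinset u).Nonempty := Finset.card_pos.1 (hdeg u)
  rw [simpleStep, dif_pos h, PMF.uniformOfFinset_apply]
  simp only [SimpleGraph.mem_neighborFinset, SimpleGraph.card_neighborFinset_eq_degree]
  split_ifs <;> simp

lemma lazyStep_toReal [DecidableEq V] (u w : V) :
    (lazyStep G u w).toReal
      = 1 / 2 * (if w = u then 1 else 0) + 1 / 2 * (simpleStep G u w).toReal := by
  rw [lazyStep, PMF.bind_apply, tsum_fintype, Fintype.sum_bool]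
  simp only [PMF.uniformOfFintype_apply, Fintype.card_bool, if_true, Bool.false_eq_true, if_false,
    PMF.pure_apply]
  rw [ENNReal.toReal_add (by split_ifs <;> simp)
    (ENNReal.mul_ne_top (by simp) (PMF.apply_ne_top _ _)), ENNReal.toReal_mul, ENNReal.toReal_mul]
  split_ifs <;> simp

lemma simpleStep_reversible (hdeg : ∀ u, 0 < G.degree u) (m : ℝ) (u w : V) :
    (G.degree u : ℝ) / m * (simpleStep G u w).toReal
      = (G.degree w : ℝ) / m * (simpleStep G w u).toReal := by
  rw [simpleStep_toReal G hdeg, simpleStep_toReal G hdeg]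
  have h1 : (G.degree u : ℝ) ≠ 0 := by exact_mod_cast (hdeg u).ne'
  have h2 : (G.degree w : ℝ) ≠ 0 := by exact_mod_cast (hdeg w).ne'
  by_cases h : G.Adj u w
  · rw [if_pos h, if_pos h.symm]
    field_simp
  · rw [if_neg h, if_neg fun h' => h h'.symm, mul_zero, mul_zero]

lemma lazyStep_reversible (hdeg : ∀ u, 0 < G.degree u) (m : ℝ) (u w : V) :
    (G.degree u : ℝ) / m * (lazyStep G u w).toReal
      = (G.degree w : ℝ) / m * (lazyStep G w u).toReal := by
  classical
  rw [lazyStep_toReal, lazyStep_toReal]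
  by_cases h : w = u
  · rw [h]
  · rw [if_neg h, if_neg (Ne.symm h)]
    linear_combination 1 / 2 * simpleStep_reversible G hdeg m u w

end Graph

end MultipleWalks

theorem theorem3p4 :
    ∃ c : ℝ, 0 < c ∧
      ∀ (V : Type*) [Fintype V] [MeasurableSpace V] [DiscreteMeasurableSpace V]
        (G : SimpleGraph V) [DecidableRel G.Adj] (k : ℕ),
        G.Connected → 1 ≤ k →
        (k : ℝ) ≤ c * ((Fintype.card V : ℝ) * Real.log (Fintype.card V)) →
        ENNReal.ofReal (c * ((Fintype.card V : ℝ) / k) * Real.log (Fintype.card V)) ≤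
            MultipleWalks.expectedCoverTime (MultipleWalks.simpleStep G)
              (MultipleWalks.stationary G) k ∧
        ENNReal.ofReal (c * ((Fintype.card V : ℝ) / k) * Real.log (Fintype.card V)) ≤
            MultipleWalks.expectedCoverTime (MultipleWalks.lazyStep G)
              (MultipleWalks.stationary G) k := by
  refine ⟨1 / (72 * 33 ^ 8), by norm_num, ?_⟩
  intro V _ _ _ G _ k hconn hk hkn
  classical
  -- For `n ≤ 1` the product `n log n` is zero, contradicting `1 ≤ k`.
  have hV : 2 ≤ Fintype.card V := by
    by_contra! hlt
    have hlog : (Fintype.card V : ℝ) * Real.log (Fintype.card V) = 0 := by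
      obtain h | h : Fintype.card V = 0 ∨ Fintype.card V = 1 := by omega
      · simp [h]
      · simp [h]
    rw [hlog, mul_zero] at hkn
    have : (1 : ℝ) ≤ k := by exact_mod_cast hk
    linarith
  have hnt : Nontrivial V := Fintype.one_lt_card_iff_nontrivial.1 hV
  have hdeg : ∀ u, 0 < G.degree u := fun u => hconn.preconnected.degree_pos_of_nontrivial u
  have hsum : ∑ u, (G.degree u : ℝ) = 2 * (G.edgeFinset.card : ℝ) := by
    exact_mod_cast G.sum_degrees_eq_twice_card_edges
  have hm : (0 : ℝ) < 2 * (G.edgeFinset.card : ℝ) := by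
    rw [← hsum]
    exact Finset.sum_pos (fun u _ => by exact_mod_cast hdeg u) ⟨hnt.to_nonempty.some, by simp⟩
  set π : V → ℝ := fun u => (G.degree u : ℝ) / (2 * (G.edgeFinset.card : ℝ)) with hπdef
  have hπ : ∀ u, 0 < π u := fun u => div_pos (by exact_mod_cast hdeg u) hm
  have hπ1 : ∑ u, π u = 1 := by
    rw [← Finset.sum_div, hsum, div_self hm.ne']
  have hst : MultipleWalks.stationary G = ∑ v, ENNReal.ofReal (π v) • Measure.dirac v := by
    refine Finset.sum_congr rfl fun v _ => ?_
    rw [hπdef, ENNReal.ofReal_div_of_pos hm, ENNReal.ofReal_mul (by norm_num),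
      ENNReal.ofReal_natCast, ENNReal.ofReal_natCast, ENNReal.ofReal_ofNat]
  rw [hst]
  exact ⟨MultipleWalks.expectedCoverTime_ge hπ hπ1
      (MultipleWalks.simpleStep_reversible G hdeg _) hk hV hkn,
    MultipleWalks.expectedCoverTime_ge hπ hπ1
      (MultipleWalks.lazyStep_reversible G hdeg _) hk hV hkn⟩
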